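/- For a topological space $X$ and $A\subseteq X$ let $\mathrm{cl}_\theta(A)$ be the set of all $y\in X$ such that $\overline U\cap A\neq\emptyset$ for every neighbourhood $U$ of $y$. For $x\in X$ let: - $\Omega^\theta_x$ be the family of all $A\subseteq X\setminus\{x\}$ with $x\in \mathrm{cl}_\theta(A)$; - $\Omega^{\theta,gp}_x$ be the family of all $A\subseteq X\setminus\{x\}$ that can be written as $A=\bigcup_{n<\omega}C_n$ with pairwise disjoint finite sets $C_n$ such that, for each open $U\ni x$, $\overline U\cap C_n\ne\emptyset$ for all but finitely many $n$; - $t_\theta(X,x)$ be the least infinite cardinal $\lambda$ such that each $A\in\Omega^\theta_x$ contains a set $C$ with $x\in\mathrm{cl}_\theta(C)$ and $|C|\le\lambda$; - $\chi_\theta(X,x)$ be the least cardinality of a family $\mathcal N$ of nonempty open sets such that for each open $U\ni x$ there is $N\in\mathcal N$ with $x\in N\subseteq\overline U$. For families $\mathcal A,\mathcal B$ of subsets of $X$, $\mathsf S_{fin}(\mathcal A,\mathcal B)$ says that for each sequence $(A_n)_{n<\omega}$ in $\mathcal A$ there are finite sets $B_n\subseteq A_n$ with $\bigcup_n B_n\in\mathcal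 B$. In the game $\mathsf G_{fin}(\mathcal A,\mathcal B)$, in each inning $n<\omega$ ONE chooses $O_n\in\mathcal A$ and TWO answers with a finite $T_n\subseteq O_n$; TWO wins if $\bigcup_n T_n\in\mathcal B$, and otherwise ONE wins. Let $\mathfrak b$ be the least cardinality of a family of functions $\omega\to\omega$ that has no upper bound with respect to eventual domination. **Theorem.** For every infinite cardinal $\kappa$ the following are equivalent: 1. $\kappa<\mathfrak b$. 2. For each $\mathsf T_1$ space $X$ without isolated points and each $x\in X$ such that $\overline U\cap A$ is infinite for all $A\in\Omega^\theta_x$ and all open $U\ni x$, if $t_\theta(X,x)=\aleph_0$ and $\chi_\theta(X,x)\le\kappa$, then ONE has no winning strategy in $\mathsf G_{fin}(\Omega^\theta_x,\Omega^{\theta,gp}_x)$. 3. For each $X$ and $x$ as in (2), that is, with the same conditions on $X$ and $x$ and with $t_\theta(X,x)=\aleph_0$ and $\chi_\theta(X,x)\le\kappa$, the selection principle $\mathsf S_{fin}(\Omega^\theta_x,\Omega^{\theta,gp}_x)$ holds. -/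

import Mathlib

open Set Filter Topology Cardinal

universe u

/-- The bounding number `𝔟`: the least cardinality of a family of functions `ℕ → ℕ` which has no
upper bound with respect to eventual domination. -/
noncomputable def boundingNumber : Cardinal.{0} :=
  sInf {c | ∃ F : Set (ℕ → ℕ), (¬ ∃ g : ℕ → ℕ, ∀ f ∈ F, ∀ᶠ n in atTop, f n ≤ g n) ∧ #F = c}

section Topological

variable {X : Type u} [TopologicalSpace X]

/-- The `θ`-closure of `A`: the points all of whose neighbourhoods have closures meeting `A`. -/
def thetaClosure (A : Set X) : Set X :=
  {x | ∀ U ∈ 𝓝 x, (closure U ∩ A).Nonempty}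

/-- `Ω^θ_x`. -/
def OmegaTheta (x : X) : Set (Set X) :=
  {A | A ⊆ {x}ᶜ ∧ x ∈ thetaClosure A}

/-- `A` groups `θ`-tightly at `x`: `A` is the union of pairwise disjoint finite sets `C 0, C 1, …`
such that the closure of each open neighbourhood of `x` meets all but finitely many of them. -/
def GroupsThetaTightly (x : X) (A : Set X) : Prop :=
  ∃ C : ℕ → Set X, (∀ n, (C n).Finite) ∧ Pairwise (fun m n => Disjoint (C m) (C n)) ∧
    (⋃ n, C n) = A ∧
    ∀ U : Set X, IsOpen U → x ∈ U → ∀ᶠ n in atTop, (closure U ∩ C n).Nonempty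

/-- `Ω^{θ,gp}_x`. -/
def OmegaThetaGp (x : X) : Set (Set X) :=
  {A | A ⊆ {x}ᶜ ∧ GroupsThetaTightly x A}

/-- The `θ`-tightness `t_θ(X, x)`. -/
noncomputable def thetaTightness (x : X) : Cardinal.{u} :=
  sInf {c | ℵ₀ ≤ c ∧ ∀ A ⊆ ({x}ᶜ : Set X), x ∈ thetaClosure A →
    ∃ C ⊆ A, x ∈ thetaClosure C ∧ #C ≤ c}

/-- `N` is a `θ`-neighbourhood base at `x`: a family of nonempty open sets such that for each open
`U` containing `x` there is `V ∈ N` with `x ∈ V ⊆ closure U`. -/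
def IsThetaNhdBase (x : X) (N : Set (Set X)) : Prop :=
  (∀ V ∈ N, IsOpen V ∧ V.Nonempty) ∧
    ∀ U : Set X, IsOpen U → x ∈ U → ∃ V ∈ N, x ∈ V ∧ V ⊆ closure U

/-- The `θ`-character `χ_θ(X, x)`. -/
noncomputable def thetaCharacter (x : X) : Cardinal.{u} :=
  sInf {c | ∃ N : Set (Set X), IsThetaNhdBase x N ∧ #N = c}

end Topological

section Selection

variable {X : Type u}

/-- The selection principle `S_fin(𝒜, ℬ)`. -/
def SFin (𝒜 ℬ : Set (Set X)) : Prop :=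
  ∀ A : ℕ → Set X, (∀ n, A n ∈ 𝒜) →
    ∃ B : ℕ → Set X, (∀ n, B n ⊆ A n ∧ (B n).Finite) ∧ (⋃ n, B n) ∈ ℬ

/-- `σ` is a winning strategy for ONE in the game `G_fin(𝒜, ℬ)`. The strategy gives the next move
of ONE, a member of `𝒜`, in terms of the list of all the previous moves of TWO, first move first;
TWO answers with a finite subset of ONE's move. ONE wins if the union of TWO's moves is not
in `ℬ`. -/
def IsWinningStrategyOneGFin (𝒜 ℬ : Set (Set X)) (σ : List (Finset X) → Set X) : Prop :=
  (∀ s, σ s ∈ 𝒜) ∧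
    ∀ T : ℕ → Finset X, (∀ n, (T n : Set X) ⊆ σ ((List.range n).map T)) →
      (⋃ n, (T n : Set X)) ∉ ℬ

end Selection

/-! For 1 → 2, fix a strategy of ONE. Tightness lets each move of ONE be thinned to a sequence
avoiding TWO's earlier choices, and TWO plays initial segments of these sequences. Positions are
then coded by finite lists of naturals, a denumerable set. Each member of a small θ-base becomes a
function on codes, saying how long a segment must be to meet its closure. With fewer than 𝔟 such
functions, one `h` dominates them all along any play without repeated codes; TWO follows `h`, and
the innings are themselves the groups (`not_exists_isWinningStrategyOneGFin`).

For 3 → 1, if 𝔟 ≤ κ, an unbounded family of size 𝔟 defines the neighbourhoods of the vertex of a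
fan. A groupable selection from its columns would yield a bound for that family (`Fan.not_sFin`). -/

/-- A family of fewer than `𝔟` functions on a denumerable set is dominated by a single function
along every injective sequence. -/
theorem exists_eventually_bound {ι : Type u} {S : Type*} [Denumerable S]
    (hι : #ι < Cardinal.lift.{u} boundingNumber) (g : ι → S → ℕ) :
    ∃ h : S → ℕ, ∀ i, ∀ s : ℕ → S, Function.Injective s → ∀ᶠ n in atTop, g i (s n) ≤ h (s n) := by
  let e : S ≃ ℕ := Denumerable.eqv S
  let F : Set (ℕ → ℕ) := range fun i n => g i (e.symm n)
  have hF : ∃ h : ℕ → ℕ, ∀ f ∈ F, ∀ᶠ n in atTop, f n ≤ h n := by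
    by_contra hF
    have h1 : boundingNumber ≤ #F := csInf_le' ⟨F, hF, rfl⟩
    have h2 : Cardinal.lift.{u} #F ≤ Cardinal.lift.{0} #ι := mk_range_le_lift
    rw [Cardinal.lift_id'.{0, u}] at h2
    exact absurd (hι.trans_le ((Cardinal.lift_le.2 h1).trans h2)) (lt_irrefl _)
  obtain ⟨h, hh⟩ := hF
  refine ⟨h ∘ e, fun i s hs => ?_⟩
  have h1 := hh _ ⟨i, rfl⟩
  have h2 : Tendsto (e ∘ s) atTop atTop := (e.injective.comp hs).nat_tendsto_atTop
  simpa using h2.eventually h1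

theorem exists_unbounded_family :
    ∃ F : Set (ℕ → ℕ), (¬ ∃ g : ℕ → ℕ, ∀ f ∈ F, ∀ᶠ n in atTop, f n ≤ g n) ∧
      #F = boundingNumber := by
  have h : {c | ∃ F : Set (ℕ → ℕ), (¬ ∃ g : ℕ → ℕ, ∀ f ∈ F, ∀ᶠ n in atTop, f n ≤ g n) ∧
      #F = c}.Nonempty := by
    refine ⟨_, univ, ?_, rfl⟩
    rintro ⟨g, hg⟩
    obtain ⟨n, hn⟩ := (hg (fun n => g n + 1) (mem_univ _)).exists
    omega
  exact csInf_mem h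

/-! ### TWO defeats every strategy of ONE below 𝔟. -/

section Game

variable {X : Type u} [TopologicalSpace X] {x : X}

theorem exists_thetaNhdBase (x : X) :
    ∃ N : Set (Set X), IsThetaNhdBase x N ∧ #N = thetaCharacter x := by
  have h : {c | ∃ N : Set (Set X), IsThetaNhdBase x N ∧ #N = c}.Nonempty :=
    ⟨_, {V | IsOpen V ∧ V.Nonempty}, ⟨fun _ h => h, fun U hU hx =>
      ⟨U, ⟨hU, x, hx⟩, hx, subset_closure⟩⟩, rfl⟩
  exact csInf_mem h

theorem exists_subset_mk_le_thetaTightness {A : Set X} (hA : A ∈ OmegaTheta x) :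
    ∃ C ⊆ A, x ∈ thetaClosure C ∧ #C ≤ thetaTightness x := by
  have h : {c | ℵ₀ ≤ c ∧ ∀ A ⊆ ({x}ᶜ : Set X), x ∈ thetaClosure A →
      ∃ C ⊆ A, x ∈ thetaClosure C ∧ #C ≤ c}.Nonempty :=
    ⟨max ℵ₀ #X, le_max_left _ _, fun A _ hx =>
      ⟨A, subset_rfl, hx, (mk_set_le A).trans (le_max_right _ _)⟩⟩
  exact (csInf_mem h).2 A hA.1 hA.2

theorem mem_thetaClosure_of_isOpen {A : Set X}
    (h : ∀ U : Set X, IsOpen U → x ∈ U → (closure U ∩ A).Nonempty) : x ∈ thetaClosure A := by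
  intro U hU
  obtain ⟨V, hVU, hV, hxV⟩ := mem_nhds_iff.1 hU
  exact (h V hV hxV).mono (inter_subset_inter_left _ (closure_mono hVU))

/-- By `hinf`, removing a finite set leaves a member of `OmegaTheta x`; countable tightness then
supplies a sequence. -/
theorem exists_seq_avoiding
    (hinf : ∀ A ∈ OmegaTheta x, ∀ U : Set X, IsOpen U → x ∈ U → (closure U ∩ A).Infinite)
    (ht : thetaTightness x = ℵ₀) {A : Set X} (hA : A ∈ OmegaTheta x) {F : Set X}
    (hF : F.Finite) :
    ∃ a : ℕ → X, (∀ n, a n ∈ A \ F) ∧ ∀ U : Set X, IsOpen U → x ∈ U → ∃ k, a k ∈ closure U := by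
  have hAF : A \ F ∈ OmegaTheta x := by
    refine ⟨sdiff_subset.trans hA.1, mem_thetaClosure_of_isOpen fun U hU hx => ?_⟩
    rw [← inter_sdiff_assoc]
    exact ((hinf A hA U hU hx).sdiff hF).nonempty
  obtain ⟨C, hC, hxC, hCc⟩ := exists_subset_mk_le_thetaTightness hAF
  rw [ht, Cardinal.mk_le_aleph0_iff] at hCc
  have hne : C.Nonempty := (hxC univ univ_mem).mono inter_subset_right
  obtain ⟨a, ha⟩ := (countable_coe_iff.1 hCc).exists_eq_range hne
  refine ⟨a, fun n => hC (ha ▸ mem_range_self n), fun U hU hx => ?_⟩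
  obtain ⟨y, hy, hyC⟩ := hxC U (hU.mem_nhds hx)
  rw [ha] at hyC
  obtain ⟨k, rfl⟩ := hyC
  exact ⟨k, hy⟩

/-- The moves of TWO coded by a list of natural numbers, last move first, when `move s k` is the
`k`-th possible move of TWO at the position `s`. -/
def codedPosition {α : Type*} (move : List α → ℕ → α) : List ℕ → List α
  | [] => []
  | k :: l => codedPosition move l ++ [move (codedPosition move l) k]

/-- The codes of the positions of the play in which TWO plays according to `h`. -/
def codedPlay (h : List ℕ → ℕ) : ℕ → List ℕ
  | 0 => []
  | n + 1 => h (codedPlay h n) :: codedPlay h n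

theorem length_codedPlay (h : List ℕ → ℕ) (n : ℕ) : (codedPlay h n).length = n := by
  induction n with
  | zero => rfl
  | succ n ih => simp [codedPlay, ih]

/-- The length of a code recovers the inning, so `exists_eventually_bound` applies along the play.
-/
theorem injective_codedPlay (h : List ℕ → ℕ) : Function.Injective (codedPlay h) := by
  intro m n hmn
  rw [← length_codedPlay h m, hmn, length_codedPlay]

theorem map_range_codedPlay {α : Type*} (move : List α → ℕ → α) (h : List ℕ → ℕ) (n : ℕ) :
    (List.range n).map (fun m => move (codedPosition move (codedPlay h m)) (h (codedPlay h m))) =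
      codedPosition move (codedPlay h n) := by
  induction n with
  | zero => rfl
  | succ n ih => rw [List.range_succ, List.map_append, ih]; rfl

theorem not_exists_isWinningStrategyOneGFin {κ : Cardinal.{u}}
    (hκ : κ < Cardinal.lift.{u} boundingNumber)
    (hinf : ∀ A ∈ OmegaTheta x, ∀ U : Set X, IsOpen U → x ∈ U → (closure U ∩ A).Infinite)
    (ht : thetaTightness x = ℵ₀) (hχ : thetaCharacter x ≤ κ) :
    ¬ ∃ σ : List (Finset X) → Set X,
      IsWinningStrategyOneGFin (OmegaTheta x) (OmegaThetaGp x) σ := by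
  classical
  rintro ⟨σ, hσ, hwin⟩
  obtain ⟨N, hN, hNc⟩ := exists_thetaNhdBase x
  have hE : ∀ s : List (Finset X), ∃ a : ℕ → X,
      (∀ n, a n ∈ σ s \ ⋃ t ∈ s, (t : Set X)) ∧
        ∀ U : Set X, IsOpen U → x ∈ U → ∃ k, a k ∈ closure U := fun s =>
    exists_seq_avoiding hinf ht (hσ s) ((List.finite_toSet s).biUnion fun t _ => t.finite_toSet)
  choose E hE hEU using hE
  let move : List (Finset X) → ℕ → Finset X := fun s k => (Finset.range (k + 1)).image (E s)
  -- Members of the θ-base need not contain `x`; those that do not get the dummy value 0.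
  have hg : ∀ (V : N) (l : List ℕ), ∃ k,
      x ∈ (V : Set X) → E (codedPosition move l) k ∈ closure (V : Set X) := by
    intro V l
    by_cases hx : x ∈ (V : Set X)
    · obtain ⟨k, hk⟩ := hEU (codedPosition move l) V (hN.1 V V.2).1 hx
      exact ⟨k, fun _ => hk⟩
    · exact ⟨0, fun h => absurd h hx⟩
  choose g hg using hg
  obtain ⟨h, hh⟩ := exists_eventually_bound ((hNc.trans_le hχ).trans_lt hκ) g
  let T : ℕ → Finset X := fun n => move (codedPosition move (codedPlay h n)) (h (codedPlay h n))
  have hT : ∀ n, (List.range n).map T = codedPosition move (codedPlay h n) :=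
    map_range_codedPlay move h
  have hTE : ∀ n, ∀ y ∈ T n, ∃ k, E ((List.range n).map T) k = y := by
    intro n y hy
    rw [hT]
    obtain ⟨k, -, hk⟩ := Finset.mem_image.1 hy
    exact ⟨k, hk⟩
  have hTσ : ∀ n, (T n : Set X) ⊆ σ ((List.range n).map T) := by
    intro n y hy
    obtain ⟨k, rfl⟩ := hTE n y hy
    exact (hE _ k).1
  have hdisj : ∀ m n, m < n → Disjoint (T m : Set X) (T n) := by
    intro m n hmn
    rw [Set.disjoint_left]
    intro y hym hyn
    obtain ⟨k, rfl⟩ := hTE n y hyn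
    exact (hE _ k).2 (mem_biUnion (List.mem_map.2 ⟨m, List.mem_range.2 hmn, rfl⟩) hym)
  refine hwin T hTσ ⟨iUnion_subset fun n => (hTσ n).trans (hσ _).1, fun n => (T n : Set X),
    fun n => (T n).finite_toSet, fun m n hmn => ?_, rfl, fun U hU hx => ?_⟩
  · rcases lt_or_gt_of_ne hmn with h' | h'
    · exact hdisj m n h'
    · exact (hdisj n m h').symm
  · obtain ⟨V, hV, hxV, hVU⟩ := hN.2 U hU hx
    filter_upwards [hh ⟨V, hV⟩ _ (injective_codedPlay h)] with n hn
    refine ⟨_, closure_minimal hVU isClosed_closure (hg ⟨V, hV⟩ (codedPlay h n) hxV), ?_⟩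
    exact Finset.mem_coe.2 (Finset.mem_image_of_mem _ (Finset.mem_range.2 (Nat.lt_succ_of_le hn)))

end Game

/-- A sequence refuting the selection principle wins for ONE when played regardless of TWO's
answers. -/
theorem sFin_of_not_exists_isWinningStrategyOneGFin {X : Type u} {𝒜 ℬ : Set (Set X)}
    (h : ¬ ∃ σ : List (Finset X) → Set X, IsWinningStrategyOneGFin 𝒜 ℬ σ) : SFin 𝒜 ℬ := by
  intro A hA
  by_contra hB
  refine h ⟨fun s => A s.length, fun s => hA _, fun T hT hTB => hB ⟨fun n => (T n : Set X),
    fun n => ⟨?_, (T n).finite_toSet⟩, hTB⟩⟩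
  simpa using hT n

/-! ### The counterexample from an unbounded family. -/

section Fan

/-- The function `n ↦ c + ∑ f, ∑ i ≤ n, f i`, where `f` runs over the list `L`. -/
def fanFunction {F : Set (ℕ → ℕ)} (p : List F × ℕ) (n : ℕ) : ℕ :=
  p.2 + (p.1.map fun f => ∑ i ∈ Finset.range (n + 1), f.1 i).sum

theorem fanFunction_mono {F : Set (ℕ → ℕ)} (p : List F × ℕ) : Monotone (fanFunction p) := by
  intro m n hmn
  refine Nat.add_le_add_left (List.sum_le_sum fun f _ => ?_) _
  exact Finset.sum_le_sum_of_subset (Finset.range_mono (by omega))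

theorem le_fanFunction_singleton {F : Set (ℕ → ℕ)} (f : F) (n : ℕ) :
    f.1 n ≤ fanFunction ([f], 0) n := by
  simpa [fanFunction] using
    Finset.single_le_sum (f := f.1) (fun _ _ => Nat.zero_le _) (Finset.self_mem_range_succ n)

/-- The points of the fan other than its vertex. -/
abbrev FanPoint : Type u := ULift.{u} (ℕ × ℕ × ℚ)

/-- A fan with copies of `ℚ` in place of the isolated points: the neighbourhoods of the vertex
`none` are given by the functions generated by `F`. -/
def Fan (_F : Set (ℕ → ℕ)) : Type u := Option FanPoint.{u}

variable {F : Set (ℕ → ℕ)}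

/-- The points on or above the graph of `fanFunction p`. -/
def fanAbove (p : List F × ℕ) : Set FanPoint.{u} := {y | fanFunction p y.down.1 ≤ y.down.2.1}

theorem fanAbove_append_subset (p q : List F × ℕ) :
    fanAbove.{u} (p.1 ++ q.1, p.2 + q.2) ⊆ fanAbove p ∩ fanAbove q := by
  intro y hy
  simp only [fanAbove, fanFunction, mem_inter_iff, mem_ofPred_eq, List.map_append,
    List.sum_append] at hy ⊢
  omega

theorem isClopen_fanAbove (p : List F × ℕ) : IsClopen (fanAbove.{u} p) := by
  have h : Continuous fun y : FanPoint.{u} => (y.down.1, y.down.2.1) := by fun_prop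
  exact (isClopen_discrete {z : ℕ × ℕ | fanFunction p z.1 ≤ z.2}).preimage h

instance : TopologicalSpace (Fan.{u} F) where
  IsOpen s := IsOpen {y : FanPoint.{u} | some y ∈ s} ∧
    (none ∈ s → ∃ p : List F × ℕ, ∀ y ∈ fanAbove.{u} p, some y ∈ s)
  isOpen_univ := ⟨isOpen_univ, fun _ => ⟨([], 0), fun _ _ => mem_univ _⟩⟩
  isOpen_inter s t hs ht := by
    refine ⟨hs.1.inter ht.1, fun h => ?_⟩
    obtain ⟨p, hp⟩ := hs.2 h.1
    obtain ⟨q, hq⟩ := ht.2 h.2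
    exact ⟨_, fun y hy => ⟨hp y (fanAbove_append_subset p q hy).1,
      hq y (fanAbove_append_subset p q hy).2⟩⟩
  isOpen_sUnion S hS := by
    constructor
    · have h : {y : FanPoint.{u} | some y ∈ ⋃₀ S} =
          ⋃ s ∈ S, {y : FanPoint.{u} | some y ∈ s} := by
        ext y; simp only [mem_ofPred_eq, mem_iUnion, exists_prop]; rfl
      rw [h]
      exact isOpen_biUnion fun s hs => (hS s hs).1
    · rintro ⟨s, hs, h⟩
      obtain ⟨p, hp⟩ := (hS s hs).2 h
      exact ⟨p, fun y hy => ⟨s, hs, hp y hy⟩⟩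

namespace Fan

/-- The vertex of the fan. -/
def vertex : Fan.{u} F := none

/-- The inclusion of the points other than the vertex. -/
def point (y : FanPoint.{u}) : Fan.{u} F := some y

theorem point_injective : Function.Injective (point : FanPoint.{u} → Fan.{u} F) :=
  Option.some_injective _

theorem point_ne_vertex (y : FanPoint.{u}) : (point y : Fan.{u} F) ≠ vertex :=
  Option.some_ne_none y

theorem eq_vertex_or_point (z : Fan.{u} F) : z = vertex ∨ ∃ y, z = point y := by
  rcases z with _ | y
  · exact Or.inl rfl
  · exact Or.inr ⟨y, rfl⟩

theorem isOpen_iff {s : Set (Fan.{u} F)} :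
    IsOpen s ↔ IsOpen (point ⁻¹' s) ∧
      (vertex ∈ s → ∃ p : List F × ℕ, ∀ y ∈ fanAbove.{u} p, point y ∈ s) := Iff.rfl

/-- The basic neighbourhoods of the vertex. -/
def cone (p : List F × ℕ) : Set (Fan.{u} F) := insert vertex (point '' fanAbove p)

theorem vertex_mem_cone (p : List F × ℕ) : vertex ∈ cone.{u} p := mem_insert _ _

theorem point_mem_cone {p : List F × ℕ} {y : FanPoint.{u}} :
    point y ∈ cone p ↔ y ∈ fanAbove p := by
  simp [cone, point_ne_vertex, point_injective.mem_set_image]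

theorem isClopen_cone (p : List F × ℕ) : IsClopen (cone.{u} p) := by
  have h : point ⁻¹' cone.{u} p = fanAbove p := ext fun y => point_mem_cone
  constructor
  · rw [← isOpen_compl_iff, isOpen_iff, preimage_compl, h]
    exact ⟨(isClopen_fanAbove p).compl.isOpen, fun h => absurd (vertex_mem_cone p) h⟩
  · rw [isOpen_iff, h]
    exact ⟨(isClopen_fanAbove p).isOpen, fun _ => ⟨p, fun y => point_mem_cone.2⟩⟩

theorem exists_cone_subset {U : Set (Fan.{u} F)} (hU : IsOpen U) (h : vertex ∈ U) :
    ∃ p, cone p ⊆ U := by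
  obtain ⟨p, hp⟩ := (isOpen_iff.1 hU).2 h
  refine ⟨p, insert_subset h ?_⟩
  rintro _ ⟨y, hy, rfl⟩
  exact hp y hy

instance : Countable (Fan.{u} F) := inferInstanceAs (Countable (Option FanPoint.{u}))

instance : T1Space (Fan.{u} F) := by
  refine ⟨fun z => ?_⟩
  rw [← isOpen_compl_iff, isOpen_iff]
  rcases eq_vertex_or_point z with rfl | ⟨y, rfl⟩
  · refine ⟨?_, fun h => absurd rfl h⟩
    convert isOpen_univ
    exact eq_univ_of_forall point_ne_vertex
  · constructor
    · have h : point ⁻¹' {(point y : Fan.{u} F)}ᶜ = {y}ᶜ := by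
        ext w; simp [point_injective.eq_iff]
      rw [h]
      exact isOpen_compl_singleton
    · refine fun _ => ⟨([], y.down.2.1 + 1), fun w hw => ?_⟩
      rw [mem_compl_singleton_iff, point_injective.ne_iff]
      rintro rfl
      simp [fanAbove, fanFunction] at hw

theorem not_isOpen_singleton (z : Fan.{u} F) : ¬ IsOpen {z} := by
  intro hz
  rcases eq_vertex_or_point z with rfl | ⟨y, rfl⟩
  · obtain ⟨p, hp⟩ := exists_cone_subset hz rfl
    exact point_ne_vertex ⟨0, fanFunction p 0, 0⟩
      (hp (point_mem_cone.2 (by simp [fanAbove])))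
  · have h1 := (isOpen_iff.1 hz).1
    have h2 : Continuous fun q : ℚ => (ULift.up (y.down.1, y.down.2.1, q) : FanPoint.{u}) := by
      fun_prop
    have h3 := h1.preimage h2
    have h4 : (fun q : ℚ => (ULift.up (y.down.1, y.down.2.1, q) : FanPoint.{u})) ⁻¹'
        (point ⁻¹' {(point y : Fan.{u} F)}) = {y.down.2.2} := by
      ext q
      obtain ⟨n, m, r⟩ := y
      simp [point_injective.eq_iff]
    rw [h4] at h3
    exact _root_.not_isOpen_singleton _ h3

instance : PerfectSpace (Fan.{u} F) :=
  perfectSpace_iff_forall_not_isolated.2 fun z =>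
    neBot_iff.2 fun h => not_isOpen_singleton z ((isOpen_singleton_iff_punctured_nhds z).2 h)

theorem infinite_closure_inter {A : Set (Fan.{u} F)} (hA : A ∈ OmegaTheta vertex)
    {U : Set (Fan.{u} F)} (hU : IsOpen U) (hv : vertex ∈ U) : (closure U ∩ A).Infinite := by
  intro hfin
  obtain ⟨p, hp⟩ := exists_cone_subset hU hv
  obtain ⟨c, hc⟩ : ∃ c, ∀ y : FanPoint.{u}, point y ∈ closure U ∩ A → y.down.2.1 < c := by
    obtain ⟨c, hc⟩ := ((hfin.preimage point_injective.injOn).image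
      fun y : FanPoint.{u} => y.down.2.1).bddAbove
    exact ⟨c + 1, fun y hy => Nat.lt_succ_of_le (hc ⟨y, hy, rfl⟩)⟩
  -- Raising the cone of `p` by `c` clears the finitely many points of the intersection.
  let q : List F × ℕ := (p.1 ++ [], p.2 + c)
  obtain ⟨z, hz, hzA⟩ := hA.2 _ ((isClopen_cone q).isOpen.mem_nhds (vertex_mem_cone q))
  rw [(isClopen_cone q).isClosed.closure_eq] at hz
  rcases eq_vertex_or_point z with rfl | ⟨y, rfl⟩
  · exact hA.1 hzA rfl
  · have hy := fanAbove_append_subset p ([], c) (point_mem_cone.1 hz)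
    have h1 := hc y ⟨subset_closure (hp (point_mem_cone.2 hy.1)), hzA⟩
    have h2 := hy.2
    simp only [fanAbove, fanFunction, mem_ofPred_eq, List.map_nil, List.sum_nil] at h2
    omega

theorem thetaTightness_vertex : thetaTightness (vertex : Fan.{u} F) = ℵ₀ := by
  refine le_antisymm (csInf_le' ⟨le_rfl, fun A _ hx => ⟨A, subset_rfl, hx, ?_⟩⟩) ?_
  · exact Cardinal.mk_le_aleph0
  · exact le_csInf ⟨ℵ₀, le_rfl, fun A _ hx => ⟨A, subset_rfl, hx, Cardinal.mk_le_aleph0⟩⟩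
      fun c hc => hc.1

theorem thetaCharacter_vertex_le {κ : Cardinal.{u}} (hκ : ℵ₀ ≤ κ)
    (hF : Cardinal.lift.{u} #F ≤ κ) : thetaCharacter (vertex : Fan.{u} F) ≤ κ := by
  have hb : IsThetaNhdBase (vertex : Fan.{u} F) (range cone) := by
    refine ⟨?_, fun U hU hv => ?_⟩
    · rintro _ ⟨p, rfl⟩
      exact ⟨(isClopen_cone p).isOpen, _, vertex_mem_cone p⟩
    · obtain ⟨p, hp⟩ := exists_cone_subset hU hv
      exact ⟨_, ⟨p, rfl⟩, vertex_mem_cone p, hp.trans subset_closure⟩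
  have h0 : thetaCharacter (vertex : Fan.{u} F) ≤ _ := csInf_le' ⟨_, hb, rfl⟩
  refine h0.trans ?_
  have h1 : Cardinal.lift.{0} #(range (cone : List F × ℕ → Set (Fan.{u} F))) ≤
      Cardinal.lift.{u} #(List F × ℕ) := mk_range_le_lift
  rw [Cardinal.lift_id'.{0, u}] at h1
  refine h1.trans ?_
  rw [Cardinal.mk_prod, Cardinal.lift_id, Cardinal.lift_id, Cardinal.lift_mul, Cardinal.mk_nat,
    Cardinal.lift_aleph0]
  refine (mul_le_mul_left (Cardinal.lift_le.2 (Cardinal.mk_list_le_max F)) _).trans ?_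
  rw [Cardinal.lift_max, Cardinal.lift_aleph0]
  exact Cardinal.mul_le_of_le hκ (max_le hκ hF) hκ

/-- The `n`-th column of the fan. -/
def column (F : Set (ℕ → ℕ)) (n : ℕ) : Set (Fan.{u} F) := point '' {y | y.down.1 = n}

theorem column_mem_omegaTheta (n : ℕ) : column.{u} F n ∈ OmegaTheta vertex := by
  constructor
  · rintro _ ⟨y, -, rfl⟩
    exact point_ne_vertex y
  · refine mem_thetaClosure_of_isOpen fun U hU hv => ?_
    obtain ⟨p, hp⟩ := exists_cone_subset hU hv
    refine ⟨point ⟨n, fanFunction p n, 0⟩, subset_closure (hp (point_mem_cone.2 ?_)), _, rfl, rfl⟩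
    simp [fanAbove]

/-- Late groups lie in columns `≥ j`. Since `fanFunction` is monotone, a group meeting the cone of
`f` has height at least `f j`, so heights of suitably late groups bound all of `F`. -/
theorem not_sFin (hF : ¬ ∃ g : ℕ → ℕ, ∀ f ∈ F, ∀ᶠ n in atTop, f n ≤ g n) :
    ¬ SFin (OmegaTheta (vertex : Fan.{u} F)) (OmegaThetaGp vertex) := by
  intro hS
  obtain ⟨B, hB, -, C, hCfin, hCdisj, hCB, hC⟩ := hS (column F) column_mem_omegaTheta
  have hCmem : ∀ k, ∀ z ∈ C k, ∃ n, z ∈ B n := fun k z hz =>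
    mem_iUnion.1 (hCB ▸ mem_iUnion_of_mem k hz)
  have hBcol : ∀ n (y : FanPoint.{u}), point y ∈ B n → y.down.1 = n := by
    intro n y hy
    obtain ⟨w, hw, hwy⟩ := (hB n).1 hy
    rwa [← point_injective hwy]
  have hlow : ∀ j, ∃ k, ∀ k' ≥ k, ∀ y : FanPoint.{u}, point y ∈ C k' → j ≤ y.down.1 := by
    intro j
    have hfin : (⋃ n ∈ Finset.range j, B n).Finite :=
      (Finset.range j).finite_toSet.biUnion fun n _ => (hB n).2
    -- Disjoint groups meet a finite set in distinct points, so only finitely many meet it.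
    have hidx : {k | (C k ∩ ⋃ n ∈ Finset.range j, B n).Nonempty}.Finite := by
      have : Nonempty (Fan.{u} F) := ⟨vertex⟩
      choose! c hc using fun k (hk : (C k ∩ ⋃ n ∈ Finset.range j, B n).Nonempty) => hk
      refine Finite.of_finite_image (f := c) (hfin.subset ?_) ?_
      · rintro _ ⟨k, hk, rfl⟩
        exact (hc k hk).2
      · intro k hk l hl hkl
        by_contra hne
        exact Set.disjoint_left.1 (hCdisj hne) (hc k hk).1 (hkl ▸ (hc l hl).1)
    obtain ⟨k, hk⟩ := hidx.bddAbove
    refine ⟨k + 1, fun k' hk' y hy => ?_⟩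
    by_contra! hlt
    obtain ⟨n, hn⟩ := hCmem k' _ hy
    have : k' ≤ k := hk ⟨_, hy, mem_biUnion (Finset.mem_range.2 ((hBcol n y hn) ▸ hlt)) hn⟩
    omega
  have hhigh : ∀ k, ∃ b, ∀ y : FanPoint.{u}, point y ∈ C k → y.down.2.1 ≤ b := by
    intro k
    obtain ⟨b, hb⟩ := (((hCfin k).preimage point_injective.injOn).image
      fun y : FanPoint.{u} => y.down.2.1).bddAbove
    exact ⟨b, fun y hy => hb ⟨y, hy, rfl⟩⟩
  choose K hK using hlow
  choose b hb using hhigh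
  -- `K j` puts the group beyond column `j`; the maximum with `j` makes the index tend to infinity.
  refine hF ⟨fun j => b (max j (K j)), fun f hf => ?_⟩
  have hcone := hC (cone ([⟨f, hf⟩], 0)) (isClopen_cone _).isOpen (vertex_mem_cone _)
  have htend : Tendsto (fun j => max j (K j)) atTop atTop :=
    tendsto_atTop_mono (fun j => le_max_left _ _) tendsto_id
  filter_upwards [htend.eventually hcone] with j hj
  obtain ⟨z, hz, hzC⟩ := hj
  rw [(isClopen_cone _).isClosed.closure_eq] at hz
  obtain ⟨n, hn⟩ := hCmem _ z hzC
  obtain ⟨y, -, rfl⟩ := (hB n).1 hn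
  have h1 : fanFunction ([⟨f, hf⟩], 0) y.down.1 ≤ y.down.2.1 := point_mem_cone.1 hz
  exact (le_fanFunction_singleton ⟨f, hf⟩ j).trans <|
    (fanFunction_mono _ (hK j _ (le_max_right _ _) y hzC)).trans <| h1.trans (hb _ y hzC)

end Fan

end Fan

theorem mainTheorem6 (κ : Cardinal.{u}) (hκ : ℵ₀ ≤ κ) :
    List.TFAE
      [κ < Cardinal.lift.{u} boundingNumber,
       ∀ (X : Type u) [TopologicalSpace X] [T1Space X] [PerfectSpace X] (x : X),
         (∀ A ∈ OmegaTheta x, ∀ U : Set X, IsOpen U → x ∈ U → (closure U ∩ A).Infinite) →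
         thetaTightness x = ℵ₀ → thetaCharacter x ≤ κ →
           ¬ ∃ σ : List (Finset X) → Set X,
             IsWinningStrategyOneGFin (OmegaTheta x) (OmegaThetaGp x) σ,
       ∀ (X : Type u) [TopologicalSpace X] [T1Space X] [PerfectSpace X] (x : X),
         (∀ A ∈ OmegaTheta x, ∀ U : Set X, IsOpen U → x ∈ U → (closure U ∩ A).Infinite) →
         thetaTightness x = ℵ₀ → thetaCharacter x ≤ κ →
           SFin (OmegaTheta x) (OmegaThetaGp x)] := by
  tfae_have 1 → 2 := fun h X _ _ _ x hinf ht hχ =>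
    not_exists_isWinningStrategyOneGFin h hinf ht hχ
  tfae_have 2 → 3 := fun h X _ _ _ x hinf ht hχ =>
    sFin_of_not_exists_isWinningStrategyOneGFin (h X x hinf ht hχ)
  tfae_have 3 → 1 := by
    intro h
    by_contra! hb
    obtain ⟨F, hF, hFc⟩ := exists_unbounded_family
    exact Fan.not_sFin.{u} hF (h (Fan.{u} F) Fan.vertex
      (fun A hA U hU hv => Fan.infinite_closure_inter hA hU hv) Fan.thetaTightness_vertex
      (Fan.thetaCharacter_vertex_le hκ (hFc ▸ hb)))
  tfae_finish
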